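/- Let $q$ be a nonnegative integer, and let $A=(a_1,\dots,a_q)$ and $B=(b_1,\dots,b_q)$ be real tuples such that $B$ is weakly supermajorized by $A$, that is, $$0<a_1\le a_2\le\cdots\le a_q,\qquad 0<b_1\le b_2\le\cdots\le b_q,\qquad \sum_{i=1}^k a_i\le\sum_{i=1}^k b_i\quad(k=1,\dots,q).$$ Let $\delta>0$ and $\sigma\in\mathbb R$, and write $A+\delta=(a_1+\delta,\dots,a_q+\delta)$, $B+\delta=(b_1+\delta,\dots,b_q+\delta)$. Let ${}_{q+1}F_q(\sigma,A;B;z)$ denote the analytic continuation to $\mathbb C\setminus[1,\infty)$ of the sum of the series $$\sum_{n=0}^\infty\frac{(\sigma)_n(a_1)_n\cdots(a_q)_n}{(b_1)_n\cdots(b_q)_n\,n!}z^n\quad(|z|<1),\qquad (a)_0=1,\quad (a)_n=a(a+1)\cdots(a+n-1),$$ and similarly for ${}_{q+1}F_q(\sigma,A+\delta;B+\delta;z)$. Then both continuations exist, both functions are real at $z=-x$ for every real $x>-1$, ${}_{q+1}F_q(\sigma,A;B;-x)\neq0$ for these $x$, and the function $$x\mapsto\frac{{}_{q+1}F_q(\sigma,A+\delta;B+\delta;-x)}{{}_{q+1}F_q(\sigma,A;B;-x)}$$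 is (weakly) decreasing on $(-1,\infty)$ if $\sigma>0$ and (weakly) increasing on $(-1,\infty)$ if $\sigma<0$. -/

import Mathlib

/-- The `n`-th Taylor coefficient
`(σ)ₙ (a₁)ₙ ⋯ (a_q)ₙ / ((b₁)ₙ ⋯ (b_q)ₙ n!)` of the generalized hypergeometric series
`_{q+1}F_q(σ, A; B; z)`. -/
noncomputable def hyperCoeff {q : ℕ} (σ : ℂ) (A B : Fin q → ℂ) (n : ℕ) : ℂ :=
  (ascPochhammer ℂ n).eval σ * (∏ i, (ascPochhammer ℂ n).eval (A i)) /
    ((∏ i, (ascPochhammer ℂ n).eval (B i)) * (n.factorial : ℂ))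

/-- The complex plane cut along the ray `[1, ∞)`. -/
def cutPlane : Set ℂ := {z : ℂ | ¬ (1 ≤ z.re ∧ z.im = 0)}

/-- `f` is holomorphic in the plane cut along `[1, ∞)` and is, in the open unit disk, the sum of
the hypergeometric series. -/
structure IsHyperContinuation {q : ℕ} (σ : ℂ) (A B : Fin q → ℂ) (f : ℂ → ℂ) : Prop where
  differentiableOn : DifferentiableOn ℂ f cutPlane
  hasSum : ∀ z : ℂ, ‖z‖ < 1 → HasSum (fun n : ℕ => hyperCoeff σ A B n * z ^ n) (f z)

open Classical in
/-- The generalized hypergeometric function `_{q+1}F_q(σ, A; B; z)`: the analytic continuation of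
the hypergeometric series to the plane cut along `[1, ∞)`. Its values on the cut carry no
meaning. -/
noncomputable def hyperF {q : ℕ} (σ : ℂ) (A B : Fin q → ℂ) (z : ℂ) : ℂ :=
  if h : ∃ f : ℂ → ℂ, IsHyperContinuation σ A B f then h.choose z
  else ∑' n : ℕ, hyperCoeff σ A B n * z ^ n

theorem cutPlane_eq : cutPlane = {z : ℂ | 1 - z ∈ Complex.slitPlane} := by
  ext z
  simp only [cutPlane, Set.mem_ofPred_eq, Complex.mem_slitPlane_iff, Complex.sub_re,
    Complex.one_re, Complex.sub_im, Complex.one_im, zero_sub, ne_eq, neg_eq_zero, not_and_or,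
    not_le, sub_pos]

theorem isOpen_cutPlane : IsOpen cutPlane := by
  rw [cutPlane_eq]
  exact Complex.isOpen_slitPlane.preimage (continuous_const.sub continuous_id)

theorem isPreconnected_cutPlane : IsPreconnected cutPlane := by
  have h : cutPlane = (fun z : ℂ => 1 - z) '' Complex.slitPlane := by
    rw [cutPlane_eq]
    ext z
    constructor
    · intro hz
      exact ⟨1 - z, hz, by ring⟩
    · rintro ⟨w, hw, rfl⟩
      simpa using hw
  rw [h]
  exact (Complex.starConvex_one_slitPlane.isPathConnected
    Complex.one_mem_slitPlane).isConnected.isPreconnected.image _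
    (by fun_prop)

/-- The continuation is unique on the cut plane, so that `hyperF` does not depend on choices. -/
theorem IsHyperContinuation.eqOn {q : ℕ} {σ : ℂ} {A B : Fin q → ℂ} {f g : ℂ → ℂ}
    (hf : IsHyperContinuation σ A B f) (hg : IsHyperContinuation σ A B g) :
    Set.EqOn f g cutPlane := by
  refine (hf.differentiableOn.analyticOnNhd isOpen_cutPlane).eqOn_of_preconnected_of_eventuallyEq
    (hg.differentiableOn.analyticOnNhd isOpen_cutPlane) isPreconnected_cutPlane (z₀ := 0)
    (by simp [cutPlane]) ?_
  filter_upwards [Metric.ball_mem_nhds (0 : ℂ) one_pos] with z hz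
  have hz1 : ‖z‖ < 1 := by simpa using hz
  exact (hf.hasSum z hz1).unique (hg.hasSum z hz1)

theorem hyperF_eqOn {q : ℕ} {σ : ℂ} {A B : Fin q → ℂ} {f : ℂ → ℂ}
    (hf : IsHyperContinuation σ A B f) : Set.EqOn (hyperF σ A B) f cutPlane := by
  have h : ∃ f : ℂ → ℂ, IsHyperContinuation σ A B f := ⟨f, hf⟩
  intro z hz
  simp only [hyperF, dif_pos h]
  exact h.choose_spec.eqOn hf hz

/-- `B` is weakly supermajorized by `A`: both tuples are positive and nondecreasing, and each
partial sum of `A` is at most the corresponding partial sum of `B`. -/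
structure WeaklySupermajorizedBy {q : ℕ} (B A : Fin q → ℝ) : Prop where
  pos_A : ∀ i, 0 < A i
  mono_A : Monotone A
  pos_B : ∀ i, 0 < B i
  mono_B : Monotone B
  sum_le : ∀ k : Fin q, ∑ i ∈ Finset.Iic k, A i ≤ ∑ i ∈ Finset.Iic k, B i

/-!
The sequence `∏ᵢ (aᵢ)ₙ / (bᵢ)ₙ` interpolates to `s ↦ ∏ᵢ Γ(aᵢ + s) Γ(bᵢ) / (Γ(bᵢ + s) Γ(aᵢ))`, and
majorization makes this the moment function of a probability measure `μ` on `[0, 1]`. Indeed, the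
Euler limit for `Γ` writes it as a limit of products of the factors
`∏ᵢ (bᵢ + j + s) (aᵢ + j) / ((aᵢ + j + s) (bᵢ + j))`, and moment functions are closed under products
and limits. Each factor is a moment function: if `aᵢ ≤ bᵢ` for all `i`, it is a product of moment
functions of mixtures of a point mass at `1` and a power of a uniform variable, and in general `A`
is moved below `B` by finitely many transfers between two entries, which change the factor by a
moment function.

Integrating the binomial series, `F(z) = ∫ (1 - z t) ^ (-σ) dμ(t)` on the cut plane, and shifting
the parameters by `δ` replaces `μ` by the measure with density proportional to `t ^ δ`. Hence the
quotient at `-x` is, up to a constant, the mean of the increasing function `t ^ δ` with respect to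
the weight `(1 + x t) ^ (-σ) dμ(t)`, and it is monotone in `x` by Chebyshev's integral inequality
because `(1 + y t) / (1 + x t)` increases with `t` for `x ≤ y`.
-/

open Filter MeasureTheory Set Topology

section CompactIntegrals

variable {X : Type*} [TopologicalSpace X] [CompactSpace X] [MeasurableSpace X]
  [OpensMeasurableSpace X] {μ : Measure X}

theorem integrable_of_continuous {E : Type*} [NormedAddCommGroup E]
    [IsFiniteMeasureOnCompacts μ] {f : X → E} (hf : Continuous f) : Integrable f μ :=
  hf.integrable_of_hasCompactSupport (.of_compactSpace f)

theorem integral_pos_of_continuous [IsFiniteMeasure μ] [NeZero μ]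
    {f : X → ℝ} (hf : Continuous f) (hpos : ∀ x, 0 < f x) : 0 < ∫ x, f x ∂μ := by
  have hsupp : Function.support f = univ := eq_univ_of_forall fun x => (hpos x).ne'
  rw [integral_pos_iff_support_of_nonneg (fun x => (hpos x).le) (integrable_of_continuous hf),
    hsupp]
  exact NeZero.pos _

theorem differentiableOn_integral_of_continuousOn_deriv {𝕜 E : Type*} [RCLike 𝕜]
    [NormedAddCommGroup E] [NormedSpace ℝ E] [NormedSpace 𝕜 E]
    [IsFiniteMeasure μ] {U : Set 𝕜} (hU : IsOpen U) {k k' : 𝕜 → X → E}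
    (hk : ∀ z ∈ U, Continuous (k z)) (hk' : ContinuousOn (Function.uncurry k') (U ×ˢ univ))
    (hderiv : ∀ z ∈ U, ∀ x, HasDerivAt (fun z => k z x) (k' z x) z) :
    DifferentiableOn 𝕜 (fun z => ∫ x, k z x ∂μ) U := by
  intro z₀ hz₀
  obtain ⟨ε, hε, hball⟩ := Metric.nhds_basis_closedBall.mem_iff.1 (hU.mem_nhds hz₀)
  obtain ⟨C, hC⟩ := ((isCompact_closedBall z₀ ε).prod isCompact_univ).exists_bound_of_continuousOn
    (hk'.mono (prod_mono_left hball))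
  have hk'₀ : Continuous (k' z₀) :=
    hk'.comp_continuous (f := fun x => (z₀, x)) (by fun_prop) fun _ => ⟨hz₀, trivial⟩
  refine (hasDerivAt_integral_of_dominated_loc_of_deriv_le (bound := fun _ => C)
    (Metric.closedBall_mem_nhds z₀ hε) ?_ (integrable_of_continuous (hk z₀ hz₀))
    (integrable_of_continuous hk'₀).aestronglyMeasurable
    (ae_of_all _ fun x z hz => hC (z, x) ⟨hz, trivial⟩) (integrable_const C)
    (ae_of_all _ fun x z hz =>
      hderiv z (hball hz) x)).2.differentiableAt.differentiableWithinAt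
  filter_upwards [hU.mem_nhds hz₀] with z hz
  exact (integrable_of_continuous (hk z hz)).aestronglyMeasurable

end CompactIntegrals

-- Integrate `(u t - u s) * (f t * g s - g t * f s) ≥ 0` over the square.
theorem integral_mul_mul_integral_le_of_cross_mul_le {α : Type*} [LinearOrder α]
    [MeasurableSpace α] {μ : Measure α} [SFinite μ] {u f g : α → ℝ} (hu : Monotone u)
    (hfg : ∀ s t, s ≤ t → g t * f s ≤ f t * g s) (hf : Integrable f μ) (hg : Integrable g μ)
    (huf : Integrable (fun t => u t * f t) μ) (hug : Integrable (fun t => u t * g t) μ) :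
    (∫ t, u t * g t ∂μ) * ∫ t, f t ∂μ ≤ (∫ t, u t * f t ∂μ) * ∫ t, g t ∂μ := by
  have hnonneg : ∀ p : α × α, 0 ≤ (u p.1 - u p.2) * (f p.1 * g p.2 - g p.1 * f p.2) := by
    rintro ⟨t, s⟩
    rcases le_total s t with hst | hts
    · exact mul_nonneg (sub_nonneg.2 (hu hst)) (sub_nonneg.2 (hfg s t hst))
    · exact mul_nonneg_of_nonpos_of_nonpos (sub_nonpos.2 (hu hts)) (by linarith [hfg t s hts])
  have hexpand : ∀ p : α × α, (u p.1 - u p.2) * (f p.1 * g p.2 - g p.1 * f p.2) =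
      (u p.1 * f p.1 * g p.2 - u p.1 * g p.1 * f p.2) +
        (g p.1 * (u p.2 * f p.2) - f p.1 * (u p.2 * g p.2)) := fun p => by ring
  have hintegrable₁ : Integrable (fun p : α × α => u p.1 * f p.1 * g p.2 - u p.1 * g p.1 * f p.2)
      (μ.prod μ) := (huf.mul_prod hg).sub (hug.mul_prod hf)
  have hintegrable₂ :
      Integrable (fun p : α × α => g p.1 * (u p.2 * f p.2) - f p.1 * (u p.2 * g p.2)) (μ.prod μ) :=
    (hg.mul_prod huf).sub (hf.mul_prod hug)
  have hint : 0 ≤ ∫ p : α × α, (u p.1 - u p.2) * (f p.1 * g p.2 - g p.1 * f p.2) ∂μ.prod μ :=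
    integral_nonneg hnonneg
  simp only [hexpand] at hint
  rw [integral_add hintegrable₁ hintegrable₂, integral_sub (huf.mul_prod hg) (hug.mul_prod hf),
    integral_sub (hg.mul_prod huf) (hf.mul_prod hug),
    integral_prod_mul (fun t => u t * f t), integral_prod_mul (fun t => u t * g t),
    integral_prod_mul g fun t => u t * f t, integral_prod_mul f fun t => u t * g t] at hint
  linarith

section MomentFunctions

/-- `m` is the moment function `s ↦ ∫ t ^ s dμ(t)`, `s ≥ 0`, of the measure `μ` on `[0, 1]`. Its
values at negative `s` are unconstrained. -/
def HasMoments (μ : Measure unitInterval) (m : ℝ → ℝ) : Prop :=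
  ∀ s : ℝ, 0 ≤ s → ∫ t, (t : ℝ) ^ s ∂μ = m s

/-- `m` is the moment function `s ↦ E[T ^ s]`, `s ≥ 0`, of a random variable `T` with values in
`[0, 1]`. -/
def IsMomentFunction (m : ℝ → ℝ) : Prop :=
  ∃ μ : ProbabilityMeasure unitInterval, HasMoments μ m

theorem continuous_coe_rpow {s : ℝ} (hs : 0 ≤ s) :
    Continuous fun t : unitInterval => (t : ℝ) ^ s :=
  continuous_subtype_val.rpow_const fun _ => Or.inr hs

theorem IsMomentFunction.congr {m m' : ℝ → ℝ} (h : IsMomentFunction m)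
    (hm : ∀ s, 0 ≤ s → m s = m' s) : IsMomentFunction m' :=
  h.imp fun _ hμ s hs => (hμ s hs).trans (hm s hs)

theorem isMomentFunction_one : IsMomentFunction fun _ => 1 :=
  ⟨⟨Measure.dirac 1, inferInstance⟩, fun s _ => by simp⟩

theorem IsMomentFunction.of_tendsto {κ : Type*} {l : Filter κ} [l.NeBot] {m : κ → ℝ → ℝ}
    {M : ℝ → ℝ} (hm : ∀ j, IsMomentFunction (m j))
    (hM : ∀ s, 0 ≤ s → Tendsto (fun j => m j s) l (𝓝 (M s))) : IsMomentFunction M := by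
  choose μ hμ using hm
  let U := Ultrafilter.of l
  have hlim : Tendsto μ U (𝓝 (U.map μ).lim) := (U.map μ).le_nhds_lim
  refine ⟨(U.map μ).lim, fun s hs => tendsto_nhds_unique (f := fun j => m j s) ?_
    ((hM s hs).mono_left (Ultrafilter.of_le l))⟩
  have hcont := ProbabilityMeasure.continuous_integral_continuousMap
    (⟨fun t : unitInterval => (t : ℝ) ^ s, continuous_coe_rpow hs⟩ : C(unitInterval, ℝ))
  simp only [← hμ _ s hs]
  exact (hcont.tendsto _).comp hlim

-- The law of a product of independent random variables is the multiplicative convolution.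
theorem IsMomentFunction.mul {m₁ m₂ : ℝ → ℝ} (h₁ : IsMomentFunction m₁)
    (h₂ : IsMomentFunction m₂) : IsMomentFunction fun s => m₁ s * m₂ s := by
  obtain ⟨μ₁, hμ₁⟩ := h₁
  obtain ⟨μ₂, hμ₂⟩ := h₂
  refine ⟨⟨(μ₁ : Measure unitInterval).mconv μ₂, inferInstance⟩, fun s hs => ?_⟩
  simp only [ProbabilityMeasure.coe_mk]
  rw [integral_mconv (integrable_of_continuous (continuous_coe_rpow hs))]
  simp only [Icc.coe_mul, Real.mul_rpow (unitInterval.nonneg _) (unitInterval.nonneg _),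
    integral_const_mul, integral_mul_const, hμ₁ s hs, hμ₂ s hs]

theorem IsMomentFunction.prod {κ : Type*} (S : Finset κ) {m : κ → ℝ → ℝ}
    (h : ∀ j ∈ S, IsMomentFunction (m j)) : IsMomentFunction fun s => ∏ j ∈ S, m j s := by
  classical
  induction S using Finset.induction_on with
  | empty => simpa only [Finset.prod_empty] using isMomentFunction_one
  | insert j S hj ih =>
    simp only [Finset.prod_insert hj]
    exact (h j (S.mem_insert_self j)).mul (ih fun i hi => h i (Finset.mem_insert_of_mem hi))

theorem IsMomentFunction.add_one_sub_mul {m : ℝ → ℝ} (h : IsMomentFunction m) {p : ℝ}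
    (hp : 0 ≤ p) (hp1 : p ≤ 1) : IsMomentFunction fun s => p + (1 - p) * m s := by
  obtain ⟨μ, hμ⟩ := h
  let ν : Measure unitInterval :=
    ENNReal.ofReal p • Measure.dirac 1 + ENNReal.ofReal (1 - p) • (μ : Measure unitInterval)
  refine ⟨⟨ν, ⟨?_⟩⟩, fun s hs => ?_⟩
  · simp [ν, ← ENNReal.ofReal_add hp (sub_nonneg.2 hp1)]
  · have hint : ∀ ρ : Measure unitInterval, [IsFiniteMeasure ρ] →
        Integrable (fun t : unitInterval => (t : ℝ) ^ s) ρ :=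
      fun ρ _ => integrable_of_continuous (continuous_coe_rpow hs)
    simp only [ProbabilityMeasure.coe_mk, ν]
    rw [integral_add_measure ((hint _).smul_measure ENNReal.ofReal_ne_top)
      ((hint _).smul_measure ENNReal.ofReal_ne_top), integral_smul_measure, integral_smul_measure,
      hμ s hs]
    simp [ENNReal.toReal_ofReal hp, ENNReal.toReal_ofReal (sub_nonneg.2 hp1)]

theorem integral_coe_rpow {s : ℝ} (hs : -1 < s) :
    ∫ t : unitInterval, (t : ℝ) ^ s = 1 / (s + 1) := by
  rw [show (volume : Measure unitInterval) = Measure.comap Subtype.val volume from rfl,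
    integral_subtype_comap measurableSet_Icc (fun t : ℝ => t ^ s),
    integral_Icc_eq_integral_Ioc, ← intervalIntegral.integral_of_le zero_le_one,
    integral_rpow (Or.inl hs), Real.one_rpow, Real.zero_rpow (by linarith), sub_zero]

-- If `T` is uniform on `[0, 1]`, then `a / (a + s)` is the moment function of `T ^ (1 / a)`.
theorem isMomentFunction_div_add {a : ℝ} (ha : 0 < a) : IsMomentFunction fun s => a / (a + s) := by
  have hroot : Continuous fun t : unitInterval => (t : ℝ) ^ a⁻¹ :=
    continuous_coe_rpow (inv_nonneg.2 ha.le)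
  let root : unitInterval → unitInterval := fun t => ⟨(t : ℝ) ^ a⁻¹, Real.rpow_nonneg t.2.1 _,
    Real.rpow_le_one t.2.1 t.2.2 (inv_nonneg.2 ha.le)⟩
  have hmeas : Measurable root := (hroot.subtype_mk _).measurable
  refine ⟨⟨volume.map root, Measure.isProbabilityMeasure_map hmeas.aemeasurable⟩, fun s hs => ?_⟩
  have hpow : ∀ t : unitInterval, (root t : ℝ) ^ s = (t : ℝ) ^ (s / a) := fun t => by
    rw [← Real.rpow_mul t.2.1, inv_mul_eq_div]
  have hsa : 0 ≤ s / a := by positivity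
  simp only [ProbabilityMeasure.coe_mk]
  rw [integral_map hmeas.aemeasurable (continuous_coe_rpow hs).aestronglyMeasurable]
  simp only [hpow]
  rw [integral_coe_rpow (by linarith)]
  field_simp
  ring

theorem isMomentFunction_add_mul_div {a b : ℝ} (ha : 0 < a) (hab : a ≤ b) :
    IsMomentFunction fun s => (b + s) * a / ((a + s) * b) := by
  have hb : 0 < b := ha.trans_le hab
  refine ((isMomentFunction_div_add ha).add_one_sub_mul (p := a / b) (by positivity)
    ((div_le_one hb).2 hab)).congr fun s hs => ?_
  field_simp
  ring

end MomentFunctions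

section Transfer

variable {ι : Type*} [DecidableEq ι] {a : ι → ℝ} {i k : ι} {e : ℝ}

/-- The tuple obtained from `a` by moving the amount `e` from the entry `k` to the entry `i` (a
Robin Hood transfer when `a i + e ≤ a k`). -/
def transfer (a : ι → ℝ) (i k : ι) (e : ℝ) : ι → ℝ :=
  a + Pi.single i e - Pi.single k e

theorem transfer_apply_receiver (hik : i ≠ k) : transfer a i k e i = a i + e := by
  simp [transfer, hik]

theorem transfer_apply_donor (hik : i ≠ k) : transfer a i k e k = a k - e := by
  simp [transfer, hik.symm]

theorem transfer_apply_of_ne {j : ι} (hji : j ≠ i) (hjk : j ≠ k) : transfer a i k e j = a j := by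
  simp [transfer, hji, hjk]

theorem transfer_pos (ha : ∀ j, 0 < a j) (hik : i ≠ k) (he : 0 ≤ e) (hle : a i + e ≤ a k) (j : ι) :
    0 < transfer a i k e j := by
  have hai := ha i
  rcases eq_or_ne j i with rfl | hji
  · rw [transfer_apply_receiver hik]
    linarith
  rcases eq_or_ne j k with rfl | hjk
  · rw [transfer_apply_donor hik]
    linarith
  rw [transfer_apply_of_ne hji hjk]
  exact ha j

theorem sum_transfer (S : Finset ι) : ∑ j ∈ S, transfer a i k e j =
    ∑ j ∈ S, a j + (if i ∈ S then e else 0) - if k ∈ S then e else 0 := by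
  simp [transfer, Finset.sum_add_distrib, Finset.sum_sub_distrib]

theorem card_transfer_ne_lt [Fintype ι] {b : ι → ℝ} (hik : i ≠ k) (hi : a i ≠ b i) (hk : a k ≠ b k)
    (he : a i + e = b i) :
    (Finset.univ.filter fun j => transfer a i k e j ≠ b j).card <
      (Finset.univ.filter fun j => a j ≠ b j).card := by
  refine Finset.card_lt_card ((Finset.ssubset_iff_of_subset ?_).2 ?_)
  · refine Finset.monotone_filter_right _ fun j _ hj => ?_
    rcases eq_or_ne j i with rfl | hji
    · exact hi
    rcases eq_or_ne j k with rfl | hjk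
    · exact hk
    rwa [transfer_apply_of_ne hji hjk] at hj
  · exact ⟨i, by simp [hi], by simp [transfer_apply_receiver hik, he]⟩

end Transfer

section Majorization

variable {ι : Type*} [LinearOrder ι] [LocallyFiniteOrderBot ι] {a b : ι → ℝ}

theorem exists_lt_of_sum_Iic_le [WellFoundedLT ι]
    (hsum : ∀ k, ∑ j ∈ Finset.Iic k, a j ≤ ∑ j ∈ Finset.Iic k, b j)
    (hab : ¬a ≤ b) : ∃ i k, i < k ∧ a i < b i ∧ b k < a k ∧ ∀ j < k, a j ≤ b j := by
  simp only [Pi.le_def, not_forall, not_le] at hab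
  obtain ⟨k, hk, hmin⟩ := WellFounded.has_min (wellFounded_lt (α := ι)) {k | b k < a k} hab
  have hle : ∀ j < k, a j ≤ b j := fun j hj => not_lt.1 fun h => hmin j h hj
  by_contra! hnone
  refine (hsum k).not_gt (Finset.sum_lt_sum (fun j hj => ?_) ⟨k, by simp, hk⟩)
  rcases (Finset.mem_Iic.1 hj).lt_or_eq with hj | rfl
  · by_contra! hlt
    obtain ⟨l, hlk, hl⟩ := hnone j k hj hlt hk
    exact hl.not_ge (hle l hlk)
  · exact hk.le

theorem sum_Iic_transfer_le {i k : ι} {e : ℝ} (hik : i < k) (hi : a i + e ≤ b i)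
    (hle : ∀ j < k, a j ≤ b j) (hsum : ∀ l, ∑ j ∈ Finset.Iic l, a j ≤ ∑ j ∈ Finset.Iic l, b j)
    (l : ι) : ∑ j ∈ Finset.Iic l, transfer a i k e j ≤ ∑ j ∈ Finset.Iic l, b j := by
  rcases lt_or_ge l k with hlk | hkl
  · refine Finset.sum_le_sum fun j hj => ?_
    have hjk : j < k := (Finset.mem_Iic.1 hj).trans_lt hlk
    rcases eq_or_ne j i with rfl | hji
    · rwa [transfer_apply_receiver hik.ne]
    · rw [transfer_apply_of_ne hji hjk.ne]
      exact hle j hjk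
  · rw [sum_transfer, if_pos (Finset.mem_Iic.2 (hik.le.trans hkl)), if_pos (Finset.mem_Iic.2 hkl),
      add_sub_cancel_right]
    exact hsum l

-- Each transfer from the first surplus `b k < a k` to an earlier deficit `a i < b i` fills the
-- deficit, which makes one more entry agree with that of `b`.
theorem transfer_induction [Finite ι] (hb : Monotone b) {P : (ι → ℝ) → Prop}
    (base : ∀ a ≤ b, P a)
    (step : ∀ a i k e, i ≠ k → 0 ≤ e → a i + e ≤ a k → P (transfer a i k e) → P a)
    (hsum : ∀ k, ∑ j ∈ Finset.Iic k, a j ≤ ∑ j ∈ Finset.Iic k, b j) : P a := by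
  have := Fintype.ofFinite ι
  induction hn : (Finset.univ.filter fun j => a j ≠ b j).card using Nat.strong_induction_on
    generalizing a with
  | _ n ih =>
  by_cases hab : a ≤ b
  · exact base a hab
  obtain ⟨i, k, hik, hi, hk, hle⟩ := exists_lt_of_sum_Iic_le hsum hab
  have he : a i + (b i - a i) = b i := add_sub_cancel _ _
  refine step a i k (b i - a i) hik.ne (sub_nonneg.2 hi.le)
    (he.trans_le ((hb hik.le).trans hk.le)) (ih _ ?_ ?_ rfl)
  · exact hn ▸ card_transfer_ne_lt hik.ne hi.ne hk.ne' he
  · exact sum_Iic_transfer_le hik he.le hle hsum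

end Majorization

section LinearRatio

variable {ι : Type*} [Fintype ι] {a b c : ι → ℝ}

/-- The factor `∏ᵢ (bᵢ + s) aᵢ / ((aᵢ + s) bᵢ)` of the infinite product for a quotient of Gamma
functions, normalized to be `1` at `s = 0`. -/
noncomputable def linearRatio (a b : ι → ℝ) (s : ℝ) : ℝ :=
  ∏ i, (b i + s) * a i / ((a i + s) * b i)

theorem linearRatio_mul_linearRatio (hb : ∀ i, 0 < b i) {s : ℝ} (hs : 0 ≤ s) :
    linearRatio a b s * linearRatio b c s = linearRatio a c s := by
  simp only [linearRatio, ← Finset.prod_mul_distrib]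
  refine Finset.prod_congr rfl fun i _ => ?_
  have hbi := hb i
  field_simp

theorem isMomentFunction_linearRatio_of_le (ha : ∀ i, 0 < a i) (hab : a ≤ b) :
    IsMomentFunction (linearRatio a b) :=
  .prod _ fun i _ => isMomentFunction_add_mul_div (ha i) (hab i)

-- The function is `p + (1 - p) (a₁ / (a₁ + s)) (a₂ / (a₂ + s))`, where
-- `p = a₁ a₂ / ((a₁ + e) (a₂ - e)) ≤ 1` because the transfer brings the two entries closer.
theorem isMomentFunction_two_point_transfer {a₁ a₂ e : ℝ} (h₁ : 0 < a₁) (he : 0 ≤ e)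
    (hle : a₁ + e ≤ a₂) : IsMomentFunction fun s =>
      (a₁ + e + s) * a₁ / ((a₁ + s) * (a₁ + e)) * ((a₂ - e + s) * a₂ / ((a₂ + s) * (a₂ - e))) := by
  have h₂ : 0 < a₂ := by linarith
  have h₂' : 0 < a₂ - e := by linarith
  have hp : a₁ * a₂ / ((a₁ + e) * (a₂ - e)) ≤ 1 := by
    rw [div_le_one (by positivity)]
    nlinarith
  refine (((isMomentFunction_div_add h₁).mul (isMomentFunction_div_add h₂)).add_one_sub_mul
    (by positivity) hp).congr fun s hs => ?_
  field_simp
  ring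

theorem isMomentFunction_linearRatio_transfer [DecidableEq ι] {i k : ι} {e : ℝ}
    (ha : ∀ j, 0 < a j) (hik : i ≠ k) (he : 0 ≤ e) (hle : a i + e ≤ a k) :
    IsMomentFunction (linearRatio a (transfer a i k e)) := by
  refine (isMomentFunction_two_point_transfer (ha i) he hle).congr fun s hs => ?_
  rw [linearRatio, Fintype.prod_eq_mul i k hik, transfer_apply_receiver hik,
    transfer_apply_donor hik]
  rintro j ⟨hji, hjk⟩
  rw [transfer_apply_of_ne hji hjk]
  have haj := ha j
  exact div_self (by positivity)

theorem isMomentFunction_linearRatio [LinearOrder ι] [LocallyFiniteOrderBot ι]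
    (ha : ∀ j, 0 < a j) (hb : Monotone b)
    (hsum : ∀ k, ∑ j ∈ Finset.Iic k, a j ≤ ∑ j ∈ Finset.Iic k, b j) :
    IsMomentFunction (linearRatio a b) := by
  refine transfer_induction hb (P := fun a => (∀ j, 0 < a j) → IsMomentFunction (linearRatio a b))
    (fun a hab ha => isMomentFunction_linearRatio_of_le ha hab)
    (fun a i k e hik he hle ih ha => ?_) hsum ha
  have hpos := transfer_pos ha hik he hle
  exact ((isMomentFunction_linearRatio_transfer ha hik he hle).mul (ih hpos)).congr fun s hs =>
    linearRatio_mul_linearRatio hpos hs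

end LinearRatio

section GammaRatio

theorem tendsto_prod_range_gamma {a b s : ℝ} (ha : 0 < a) (hb : 0 < b) (hs : 0 ≤ s) :
    Tendsto (fun N => ∏ j ∈ Finset.range N, (b + j + s) * (a + j) / ((a + j + s) * (b + j))) atTop
      (𝓝 (Real.Gamma (a + s) * Real.Gamma b / (Real.Gamma (b + s) * Real.Gamma a))) := by
  rw [← tendsto_add_atTop_iff_nat 1]
  have hΓ : Real.Gamma (b + s) * Real.Gamma a ≠ 0 :=
    (mul_pos (Real.Gamma_pos_of_pos (by positivity)) (Real.Gamma_pos_of_pos ha)).ne'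
  refine (((Real.GammaSeq_tendsto_Gamma (a + s)).mul (Real.GammaSeq_tendsto_Gamma b)).div
    ((Real.GammaSeq_tendsto_Gamma (b + s)).mul (Real.GammaSeq_tendsto_Gamma a)) hΓ).congr' ?_
  filter_upwards [eventually_gt_atTop 0] with n hn
  have hprod : ∀ c : ℝ, 0 < c → ∏ j ∈ Finset.range (n + 1), (c + j) ≠ 0 := fun c hc =>
    (Finset.prod_pos fun j _ => by positivity).ne'
  have hprod_a := hprod a ha
  have hprod_b := hprod b hb
  have hprod_as := hprod (a + s) (by positivity)
  have hprod_bs := hprod (b + s) (by positivity)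
  have hn' : (0 : ℝ) < n := Nat.cast_pos.2 hn
  simp only [Finset.prod_div_distrib, Finset.prod_mul_distrib, Pi.div_apply, Real.GammaSeq,
    Real.rpow_add hn', add_right_comm _ _ s]
  simp only [add_right_comm _ s] at hprod_as hprod_bs ⊢
  field_simp

theorem gamma_add_natCast {a : ℝ} (ha : 0 < a) (n : ℕ) :
    Real.Gamma (a + n) = (ascPochhammer ℝ n).eval a * Real.Gamma a := by
  induction n with
  | zero => simp
  | succ n ih =>
    rw [Nat.cast_succ, ← add_assoc, Real.Gamma_add_one (by positivity), ih,
      ascPochhammer_succ_eval]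
    ring

variable {ι : Type*} [Fintype ι] {a b : ι → ℝ}

/-- The quotient `∏ᵢ Γ(aᵢ + s) / Γ(bᵢ + s)`, normalized to be `1` at `s = 0`. -/
noncomputable def gammaRatio (a b : ι → ℝ) (s : ℝ) : ℝ :=
  ∏ i, Real.Gamma (a i + s) * Real.Gamma (b i) / (Real.Gamma (b i + s) * Real.Gamma (a i))

theorem gammaRatio_natCast (ha : ∀ i, 0 < a i) (hb : ∀ i, 0 < b i) (n : ℕ) :
    gammaRatio a b n = ∏ i, (ascPochhammer ℝ n).eval (a i) / (ascPochhammer ℝ n).eval (b i) := by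
  refine Finset.prod_congr rfl fun i _ => ?_
  have hΓa := (Real.Gamma_pos_of_pos (ha i)).ne'
  have hΓb := (Real.Gamma_pos_of_pos (hb i)).ne'
  rw [gamma_add_natCast (ha i), gamma_add_natCast (hb i)]
  field_simp

theorem gammaRatio_add_const (ha : ∀ i, 0 < a i) (hb : ∀ i, 0 < b i) {δ : ℝ} (hδ : 0 ≤ δ)
    (s : ℝ) : gammaRatio (fun i => a i + δ) (fun i => b i + δ) s =
      gammaRatio a b (δ + s) / gammaRatio a b δ := by
  simp only [gammaRatio, ← Finset.prod_div_distrib]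
  refine Finset.prod_congr rfl fun i _ => ?_
  have hΓa := (Real.Gamma_pos_of_pos (ha i)).ne'
  have hΓb := (Real.Gamma_pos_of_pos (hb i)).ne'
  have hΓaδ := (Real.Gamma_pos_of_pos (add_pos_of_pos_of_nonneg (ha i) hδ)).ne'
  have hΓbδ := (Real.Gamma_pos_of_pos (add_pos_of_pos_of_nonneg (hb i) hδ)).ne'
  rw [add_assoc, add_assoc]
  field_simp

theorem isMomentFunction_gammaRatio [LinearOrder ι] [LocallyFiniteOrderBot ι]
    (ha : ∀ i, 0 < a i) (hb : ∀ i, 0 < b i) (hmono : Monotone b)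
    (hsum : ∀ k, ∑ j ∈ Finset.Iic k, a j ≤ ∑ j ∈ Finset.Iic k, b j) :
    IsMomentFunction (gammaRatio a b) := by
  have hfactor : ∀ j : ℕ, IsMomentFunction (linearRatio (fun i => a i + j) fun i => b i + j) :=
    fun j => isMomentFunction_linearRatio (fun i => by have := ha i; positivity)
      (hmono.add_const _) fun k => by simpa [Finset.sum_add_distrib] using hsum k
  refine .of_tendsto (l := atTop) (fun N => .prod (Finset.range N) fun j _ => hfactor j)
    fun s hs => ?_
  simp only [linearRatio, gammaRatio, Finset.prod_comm (s := Finset.range _)]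
  exact tendsto_finsetProd _ fun i _ => tendsto_prod_range_gamma (ha i) (hb i) hs

end GammaRatio

section PowerBiased

variable {μ : Measure unitInterval} {δ : ℝ}

/-- The measure with density `t ^ δ / ∫ t ^ δ dμ` with respect to `μ`; biasing by `t ^ δ` shifts
the argument of the moment function by `δ`. -/
noncomputable def powerBiased (μ : Measure unitInterval) (δ : ℝ) : Measure unitInterval :=
  μ.withDensity fun t => ENNReal.ofReal ((t : ℝ) ^ δ / ∫ t, (t : ℝ) ^ δ ∂μ)

theorem isFiniteMeasure_powerBiased [IsFiniteMeasure μ] (hδ : 0 ≤ δ) :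
    IsFiniteMeasure (powerBiased μ δ) :=
  isFiniteMeasure_withDensity_ofReal
    (integrable_of_continuous ((continuous_coe_rpow hδ).div_const _)).hasFiniteIntegral

theorem integral_powerBiased (hδ : 0 ≤ δ) (f : unitInterval → ℝ) :
    ∫ t, f t ∂powerBiased μ δ = (∫ t, (t : ℝ) ^ δ * f t ∂μ) / ∫ t, (t : ℝ) ^ δ ∂μ := by
  have hdens : ∀ t : unitInterval, 0 ≤ (t : ℝ) ^ δ / ∫ t, (t : ℝ) ^ δ ∂μ := fun t =>
    div_nonneg (Real.rpow_nonneg t.2.1 _) (integral_nonneg fun t => Real.rpow_nonneg t.2.1 _)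
  rw [powerBiased, integral_withDensity_eq_integral_toReal_smul
    (((continuous_coe_rpow hδ).div_const _).measurable.ennreal_ofReal)
    (ae_of_all _ fun _ => ENNReal.ofReal_lt_top), ← integral_div]
  refine integral_congr_ae (ae_of_all _ fun t => ?_)
  simp only [ENNReal.toReal_ofReal (hdens t), smul_eq_mul]
  ring

theorem HasMoments.powerBiased {m : ℝ → ℝ} (h : HasMoments μ m) (hδ : 0 ≤ δ) :
    HasMoments (powerBiased μ δ) fun s => m (δ + s) / m δ := fun s hs => by
  simp only [integral_powerBiased hδ, h δ hδ, ← h (δ + s) (add_nonneg hδ hs)]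
  congr 2 with t
  exact (Real.rpow_add_of_nonneg t.2.1 hδ hs).symm

end PowerBiased

section StieltjesTransform

/-- The generalized Stieltjes transform `z ↦ ∫ (1 - z t) ^ (-σ) dμ(t)` of a measure on `[0, 1]`,
which continues the hypergeometric series with coefficients `(σ)ₙ / n!` times the moments of `μ`
to the cut plane. -/
noncomputable def stieltjesTransform (μ : Measure unitInterval) (σ z : ℂ) : ℂ :=
  ∫ t, (1 - z * ((t : ℝ) : ℂ)) ^ (-σ) ∂μ

theorem hasSum_one_sub_cpow_neg (σ : ℂ) {z : ℂ} (hz : ‖z‖ < 1) :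
    HasSum (fun n : ℕ => (ascPochhammer ℂ n).eval σ / n.factorial * z ^ n) ((1 - z) ^ (-σ)) := by
  have hchoose : ∀ n : ℕ,
      Ring.choose (σ + n - 1) n = (ascPochhammer ℂ n).eval σ / n.factorial := fun n => by
    have hmultichoose := Ring.factorial_nsmul_multichoose_eq_ascPochhammer σ n
    rw [Polynomial.ascPochhammer_smeval_eq_eval, nsmul_eq_mul] at hmultichoose
    rw [eq_div_iff (by exact_mod_cast n.factorial_ne_zero), ← hmultichoose, mul_comm,
      Ring.multichoose_eq]
  have hball : z ∈ Metric.eball (0 : ℂ) 1 := by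
    rw [← ENNReal.ofReal_one, Metric.eball_ofReal]
    simpa using hz
  simpa [hchoose, Complex.cpow_neg, FormalMultilinearSeries.ofScalars, mul_comm] using
    (Complex.one_div_one_sub_cpow_hasFPowerSeriesOnBall_zero σ).hasSum hball

theorem hasSum_stieltjesTransform {μ : Measure unitInterval} [IsFiniteMeasure μ] (σ : ℂ) {z : ℂ}
    (hz : ‖z‖ < 1) :
    HasSum (fun n : ℕ => (ascPochhammer ℂ n).eval σ / n.factorial *
      ((∫ t, (t : ℝ) ^ n ∂μ : ℝ) : ℂ) * z ^ n) (stieltjesTransform μ σ z) := by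
  let term : ℕ → unitInterval → ℂ := fun n t =>
    (ascPochhammer ℂ n).eval σ / n.factorial * (z * ((t : ℝ) : ℂ)) ^ n
  have hterm : ∀ n, Integrable (term n) μ := fun n => integrable_of_continuous (by fun_prop)
  have hzt : ∀ t : unitInterval, ‖z * ((t : ℝ) : ℂ)‖ ≤ ‖z‖ := fun t => by
    rw [norm_mul, Complex.norm_of_nonneg t.2.1]
    exact mul_le_of_le_one_right (norm_nonneg _) t.2.2
  have hsum : Summable fun n => ∫ t, ‖term n t‖ ∂μ := by
    refine .of_nonneg_of_le (fun n => integral_nonneg fun t => norm_nonneg _) (fun n => ?_)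
      ((hasSum_one_sub_cpow_neg σ hz).summable.norm.mul_right (μ.real univ))
    rw [mul_comm, ← smul_eq_mul, ← integral_const]
    refine integral_mono (hterm n).norm (integrable_const _) fun t => ?_
    simp only [term, norm_mul _ (_ ^ n), norm_pow]
    gcongr
    exact hzt t
  have hterm_integral : ∀ n, ∫ t, term n t ∂μ =
      (ascPochhammer ℂ n).eval σ / n.factorial * ((∫ t, (t : ℝ) ^ n ∂μ : ℝ) : ℂ) * z ^ n :=
    fun n => by
      rw [← integral_complex_ofReal, ← integral_const_mul, ← integral_mul_const]
      congr 1 with t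
      simp only [term]
      push_cast
      ring
  have hterm_tsum : ∀ t : unitInterval, ∑' n, term n t = (1 - z * ((t : ℝ) : ℂ)) ^ (-σ) := fun t =>
    (hasSum_one_sub_cpow_neg σ ((hzt t).trans_lt hz)).tsum_eq
  simpa only [stieltjesTransform, hterm_integral, hterm_tsum] using
    hasSum_integral_of_summable_integral_norm hterm hsum

theorem one_sub_mul_mem_slitPlane {z : ℂ} (hz : z ∈ cutPlane) (t : unitInterval) :
    1 - z * ((t : ℝ) : ℂ) ∈ Complex.slitPlane := by
  rw [cutPlane_eq] at hz
  convert Complex.starConvex_one_slitPlane hz (sub_nonneg.2 t.2.2) t.2.1 (by ring) using 1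
  simp only [Complex.real_smul]
  push_cast
  ring

theorem continuousOn_one_sub_mul_cpow (c : ℂ) :
    ContinuousOn (fun p : ℂ × unitInterval => (1 - p.1 * ((p.2 : ℝ) : ℂ)) ^ c) (cutPlane ×ˢ univ) :=
  .cpow_const (by fun_prop) fun p hp => one_sub_mul_mem_slitPlane hp.1 p.2

theorem differentiableOn_stieltjesTransform {μ : Measure unitInterval} [IsFiniteMeasure μ] (σ : ℂ) :
    DifferentiableOn ℂ (stieltjesTransform μ σ) cutPlane := by
  refine differentiableOn_integral_of_continuousOn_deriv isOpen_cutPlane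
    (k' := fun z t => -σ * (1 - z * ((t : ℝ) : ℂ)) ^ (-σ - 1) * -((t : ℝ) : ℂ))
    (fun z hz => ?_) ?_ fun z hz t => ?_
  · exact (continuousOn_one_sub_mul_cpow (-σ)).comp_continuous (f := fun t : unitInterval => (z, t))
      (by fun_prop) fun _ => ⟨hz, trivial⟩
  · exact (continuousOn_const.mul (continuousOn_one_sub_mul_cpow (-σ - 1))).mul (by fun_prop)
  · have hlinear : HasDerivAt (fun z : ℂ => 1 - z * ((t : ℝ) : ℂ)) (-((t : ℝ) : ℂ)) z := by
      simpa using ((hasDerivAt_id z).mul_const ((t : ℝ) : ℂ)).const_sub 1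
    exact hlinear.cpow_const (one_sub_mul_mem_slitPlane hz t)

theorem one_add_mul_pos {x : ℝ} (hx : -1 < x) (t : unitInterval) : 0 < 1 + x * (t : ℝ) := by
  rcases t.2.1.eq_or_lt with ht | ht
  · simp [← ht]
  · nlinarith [t.2.2, mul_pos (neg_lt_iff_pos_add.1 hx) ht]

theorem stieltjesTransform_neg_ofReal (μ : Measure unitInterval) (σ : ℝ) {x : ℝ} (hx : -1 < x) :
    stieltjesTransform μ σ (-x) = ((∫ t, (1 + x * (t : ℝ)) ^ (-σ) ∂μ : ℝ) : ℂ) := by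
  rw [stieltjesTransform, ← integral_complex_ofReal]
  congr 1 with t
  rw [Complex.ofReal_cpow (one_add_mul_pos hx t).le]
  push_cast
  ring_nf

end StieltjesTransform

section HypergeometricFunction

variable {q : ℕ}

theorem hyperCoeff_ofReal (σ : ℂ) (A B : Fin q → ℝ) (n : ℕ) :
    hyperCoeff σ (fun i => (A i : ℂ)) (fun i => (B i : ℂ)) n =
      (ascPochhammer ℂ n).eval σ / n.factorial *
        ((∏ i, (ascPochhammer ℝ n).eval (A i) / (ascPochhammer ℝ n).eval (B i) : ℝ) : ℂ) := by
  have heval : ∀ x : ℝ, (ascPochhammer ℂ n).eval (x : ℂ) = ((ascPochhammer ℝ n).eval x : ℝ) :=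
    fun x => by
      rw [← ascPochhammer_map Complex.ofRealHom, Polynomial.eval_map]
      exact Polynomial.eval₂_at_apply Complex.ofRealHom x
  simp only [hyperCoeff, heval, Finset.prod_div_distrib]
  push_cast
  rw [div_mul_div_comm, mul_comm (n.factorial : ℂ)]

theorem IsHyperContinuation.isHyperContinuation_hyperF {σ : ℂ} {A B : Fin q → ℂ} {f : ℂ → ℂ}
    (hf : IsHyperContinuation σ A B f) : IsHyperContinuation σ A B (hyperF σ A B) := by
  have hex : ∃ f : ℂ → ℂ, IsHyperContinuation σ A B f := ⟨f, hf⟩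
  have hchoose : hyperF σ A B = hex.choose := funext fun z => by simp only [hyperF, dif_pos hex]
  exact hchoose ▸ hex.choose_spec

theorem neg_ofReal_mem_cutPlane {x : ℝ} (hx : -1 < x) : -(x : ℂ) ∈ cutPlane := by
  rintro ⟨hre, -⟩
  rw [Complex.neg_re, Complex.ofReal_re] at hre
  linarith

variable {A B : Fin q → ℝ} {μ : Measure unitInterval} [IsFiniteMeasure μ]

theorem HasMoments.isHyperContinuation_stieltjesTransform (hμ : HasMoments μ (gammaRatio A B))
    (hA : ∀ i, 0 < A i) (hB : ∀ i, 0 < B i) (σ : ℂ) :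
    IsHyperContinuation σ (fun i => (A i : ℂ)) (fun i => (B i : ℂ)) (stieltjesTransform μ σ) where
  differentiableOn := differentiableOn_stieltjesTransform σ
  hasSum z hz := by
    have hmoment : ∀ n : ℕ, ∫ t, (t : ℝ) ^ n ∂μ =
        ∏ i, (ascPochhammer ℝ n).eval (A i) / (ascPochhammer ℝ n).eval (B i) := fun n => by
      simpa only [Real.rpow_natCast, gammaRatio_natCast hA hB] using hμ n n.cast_nonneg
    simpa only [hyperCoeff_ofReal, hmoment] using hasSum_stieltjesTransform (μ := μ) σ hz

theorem HasMoments.hyperF_neg_ofReal (hμ : HasMoments μ (gammaRatio A B))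
    (hA : ∀ i, 0 < A i) (hB : ∀ i, 0 < B i) (σ : ℝ) {x : ℝ} (hx : -1 < x) :
    hyperF σ (fun i => (A i : ℂ)) (fun i => (B i : ℂ)) (-x) =
      ((∫ t, (1 + x * (t : ℝ)) ^ (-σ) ∂μ : ℝ) : ℂ) :=
  (hyperF_eqOn (hμ.isHyperContinuation_stieltjesTransform hA hB σ)
    (neg_ofReal_mem_cutPlane hx)).trans (stieltjesTransform_neg_ofReal μ σ hx)

end HypergeometricFunction

section Monotonicity

variable {x y c : ℝ}

theorem continuous_one_add_mul_rpow (hx : -1 < x) (c : ℝ) :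
    Continuous fun t : unitInterval => (1 + x * (t : ℝ)) ^ c :=
  .rpow_const (by fun_prop) fun t => Or.inl (one_add_mul_pos hx t).ne'

theorem integral_one_add_mul_rpow_pos (μ : Measure unitInterval) [IsFiniteMeasure μ] [NeZero μ]
    (hx : -1 < x) (c : ℝ) : 0 < ∫ t, (1 + x * (t : ℝ)) ^ c ∂μ :=
  integral_pos_of_continuous (continuous_one_add_mul_rpow hx c) fun t =>
    Real.rpow_pos_of_pos (one_add_mul_pos hx t) c

theorem one_add_mul_cross_mul_le {s t : ℝ} (hxy : x ≤ y) (hst : s ≤ t) :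
    (1 + x * t) * (1 + y * s) ≤ (1 + y * t) * (1 + x * s) := by
  nlinarith [mul_nonneg (sub_nonneg.2 hxy) (sub_nonneg.2 hst)]

theorem one_add_mul_rpow_cross_mul_le_of_nonneg (hx : -1 < x) (hxy : x ≤ y) (hc : 0 ≤ c)
    {s t : unitInterval} (hst : s ≤ t) :
    (1 + x * (t : ℝ)) ^ c * (1 + y * (s : ℝ)) ^ c ≤
      (1 + y * (t : ℝ)) ^ c * (1 + x * (s : ℝ)) ^ c := by
  have hpos_x := one_add_mul_pos hx
  have hpos_y := one_add_mul_pos (hx.trans_le hxy)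
  rw [← Real.mul_rpow (hpos_x t).le (hpos_y s).le, ← Real.mul_rpow (hpos_y t).le (hpos_x s).le]
  exact Real.rpow_le_rpow (mul_pos (hpos_x t) (hpos_y s)).le (one_add_mul_cross_mul_le hxy hst) hc

theorem one_add_mul_rpow_cross_mul_le_of_nonpos (hx : -1 < x) (hxy : x ≤ y) (hc : c ≤ 0)
    {s t : unitInterval} (hst : s ≤ t) :
    (1 + y * (t : ℝ)) ^ c * (1 + x * (s : ℝ)) ^ c ≤
      (1 + x * (t : ℝ)) ^ c * (1 + y * (s : ℝ)) ^ c := by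
  have hpos_x := one_add_mul_pos hx
  have hpos_y := one_add_mul_pos (hx.trans_le hxy)
  rw [← Real.mul_rpow (hpos_x t).le (hpos_y s).le, ← Real.mul_rpow (hpos_y t).le (hpos_x s).le]
  exact Real.rpow_le_rpow_of_nonpos (mul_pos (hpos_x t) (hpos_y s))
    (one_add_mul_cross_mul_le hxy hst) hc

variable {μ : Measure unitInterval} [IsFiniteMeasure μ] [NeZero μ] {δ : ℝ}

theorem integral_powerBiased_div_le_of_cross_mul_le (hδ : 0 ≤ δ) {f g : unitInterval → ℝ}
    (hf : Continuous f) (hg : Continuous g) (hf_pos : ∀ t, 0 < f t) (hg_pos : ∀ t, 0 < g t)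
    (hfg : ∀ s t, s ≤ t → g t * f s ≤ f t * g s) :
    (∫ t, g t ∂powerBiased μ δ) / ∫ t, g t ∂μ ≤ (∫ t, f t ∂powerBiased μ δ) / ∫ t, f t ∂μ := by
  have hpow := continuous_coe_rpow hδ
  have hmono : Monotone fun t : unitInterval => (t : ℝ) ^ δ := fun s t hst =>
    Real.rpow_le_rpow s.2.1 hst hδ
  rw [integral_powerBiased hδ, integral_powerBiased hδ, div_right_comm,
    div_right_comm (∫ t, _ * f t ∂μ)]
  refine div_le_div_of_nonneg_right ?_ (integral_nonneg fun t => Real.rpow_nonneg t.2.1 _)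
  rw [div_le_div_iff₀ (integral_pos_of_continuous hg hg_pos) (integral_pos_of_continuous hf hf_pos)]
  exact integral_mul_mul_integral_le_of_cross_mul_le hmono hfg (integrable_of_continuous hf)
    (integrable_of_continuous hg) (integrable_of_continuous (hpow.mul hf))
    (integrable_of_continuous (hpow.mul hg))

theorem monotoneOn_integral_powerBiased_div (hδ : 0 ≤ δ) (hc : 0 ≤ c) :
    MonotoneOn (fun x : ℝ => (∫ t, (1 + x * (t : ℝ)) ^ c ∂powerBiased μ δ) /
      ∫ t, (1 + x * (t : ℝ)) ^ c ∂μ) (Ioi (-1)) := fun _ hx _ hy hxy =>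
  integral_powerBiased_div_le_of_cross_mul_le hδ (continuous_one_add_mul_rpow hy c)
    (continuous_one_add_mul_rpow hx c)
    (fun t => Real.rpow_pos_of_pos (one_add_mul_pos hy t) c)
    (fun t => Real.rpow_pos_of_pos (one_add_mul_pos hx t) c)
    fun _ _ hst => one_add_mul_rpow_cross_mul_le_of_nonneg hx hxy hc hst

theorem antitoneOn_integral_powerBiased_div (hδ : 0 ≤ δ) (hc : c ≤ 0) :
    AntitoneOn (fun x : ℝ => (∫ t, (1 + x * (t : ℝ)) ^ c ∂powerBiased μ δ) /
      ∫ t, (1 + x * (t : ℝ)) ^ c ∂μ) (Ioi (-1)) := fun _ hx _ hy hxy =>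
  integral_powerBiased_div_le_of_cross_mul_le hδ (continuous_one_add_mul_rpow hx c)
    (continuous_one_add_mul_rpow hy c)
    (fun t => Real.rpow_pos_of_pos (one_add_mul_pos hx t) c)
    (fun t => Real.rpow_pos_of_pos (one_add_mul_pos hy t) c)
    fun _ _ hst => one_add_mul_rpow_cross_mul_le_of_nonpos hx hxy hc hst

end Monotonicity

theorem mainTheorem5 (q : ℕ) (A B : Fin q → ℝ) (hBA : WeaklySupermajorizedBy B A)
    (δ : ℝ) (hδ : 0 < δ) (σ : ℝ) (F Fδ : ℂ → ℂ)
    (hF : F = hyperF (σ : ℂ) (fun i => (A i : ℂ)) (fun i => (B i : ℂ)))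
    (hFδ : Fδ = hyperF (σ : ℂ) (fun i => ((A i + δ : ℝ) : ℂ)) (fun i => ((B i + δ : ℝ) : ℂ))) :
    -- the analytic continuations exist, so that `F` and `Fδ` are the intended functions
    IsHyperContinuation (σ : ℂ) (fun i => (A i : ℂ)) (fun i => (B i : ℂ)) F ∧
    IsHyperContinuation (σ : ℂ) (fun i => ((A i + δ : ℝ) : ℂ)) (fun i => ((B i + δ : ℝ) : ℂ)) Fδ ∧
    -- on `(-1, ∞)` the quotient is well defined and real
    (∀ x : ℝ, -1 < x →
      (F (-(x : ℂ))).im = 0 ∧ (Fδ (-(x : ℂ))).im = 0 ∧ F (-(x : ℂ)) ≠ 0) ∧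
    (0 < σ → AntitoneOn (fun x : ℝ => (Fδ (-(x : ℂ)) / F (-(x : ℂ))).re) (Set.Ioi (-1))) ∧
    (σ < 0 → MonotoneOn (fun x : ℝ => (Fδ (-(x : ℂ)) / F (-(x : ℂ))).re) (Set.Ioi (-1))) := by
  subst hF hFδ
  have hA := hBA.pos_A
  have hB := hBA.pos_B
  have hAδ := fun i => add_pos (hA i) hδ
  have hBδ := fun i => add_pos (hB i) hδ
  obtain ⟨μ, hμ⟩ := isMomentFunction_gammaRatio hA hB hBA.mono_B hBA.sum_le
  have hfinite := isFiniteMeasure_powerBiased (μ := μ) hδ.le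
  have hμδ : HasMoments (powerBiased μ δ) (gammaRatio (fun i => A i + δ) fun i => B i + δ) := by
    simpa only [funext (gammaRatio_add_const hA hB hδ.le)] using hμ.powerBiased hδ.le
  have hval := fun x (hx : -1 < x) => hμ.hyperF_neg_ofReal hA hB σ hx
  have hvalδ := fun x (hx : -1 < x) => hμδ.hyperF_neg_ofReal hAδ hBδ σ hx
  refine ⟨(hμ.isHyperContinuation_stieltjesTransform hA hB σ).isHyperContinuation_hyperF,
    (hμδ.isHyperContinuation_stieltjesTransform hAδ hBδ σ).isHyperContinuation_hyperF,
    fun x hx => ⟨?_, ?_, ?_⟩, fun hσ => ?_, fun hσ => ?_⟩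
  · rw [hval x hx, Complex.ofReal_im]
  · rw [hvalδ x hx, Complex.ofReal_im]
  · rw [hval x hx]
    exact Complex.ofReal_ne_zero.2 (integral_one_add_mul_rpow_pos _ hx _).ne'
  · refine (antitoneOn_integral_powerBiased_div (μ := μ) hδ.le (neg_nonpos.2 hσ.le)).congr
      fun x hx => ?_
    rw [hval x hx, hvalδ x hx, ← Complex.ofReal_div, Complex.ofReal_re]
  · refine (monotoneOn_integral_powerBiased_div (μ := μ) hδ.le (neg_nonneg.2 hσ.le)).congr
      fun x hx => ?_
    rw [hval x hx, hvalδ x hx, ← Complex.ofReal_div, Complex.ofReal_re]
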